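/- For $n,k\ge 0$ let $\mathcal F_{n,k}$ be the set of forests of rooted labelled trees on the vertex set $[n]=\{1,\dots,n\}$ with $k$ components. For $F\in\mathcal F_{n,k}$ let $V_r(F)$ be its set of roots, with elements $v_0<v_1<\dots<v_{k-1}$. If $F$ has a nonroot vertex, let $v_{\min}$ be the lowest-numbered vertex among all vertices whose parent is a root, and let $\mathrm{scindex}(F)$ be the $j$ for which $v_j$ is the parent of $v_{\min}$ (put $\mathrm{scindex}(F)=0$ if there is no nonroot vertex). Let $V_t(F)$ be the set of vertices that are neither a root nor $v_{\min}$. Put $$\mathrm{niblings}(F)=\sum_{v\in V_r(F)}\#\{v'\in[n]:v'\notin V_r(F),\ v'<v\},\qquad \mathrm{parents}(F)=\sum_{v\in V_t(F)}\mathrm{parent}(v),$$ where $\mathrm{parent}(v)$ is the label of the parent of $v$. In variables $r,s,t$, give a root $v$ the weight $r^{\#\{v'\notin V_r(F):\,v'<v\}}$, the vertex $v_{\min}$ the weight $s^{\mathrm{scindex}(F)}$, and a vertex $v\in V_t(F)$ the weight $t^{\mathrm{parent}(v)-1}$; let $\mathrm{wt}(F)=\mathrm{wt}_{r,s,t}(F)$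 be the product of the weights of all vertices of $F$. Write $[m]_q=1+q+\dots+q^{m-1}$, $[m]_q!=\prod_{j=1}^m[j]_q$ and $\binom{m}{l}_q=\frac{[m]_q!}{[l]_q!\,[m-l]_q!}$, a polynomial in $q$ for $0\le l\le m$. Let $f_{n,0}(q)=\delta_{n0}$, $f_{n,k}(q)=\binom{n-1}{k-1}_q([n]_q)^{n-k}$ for $n\ge k\ge1$, and $f_{n,k}(q)=0$ for $k>n$. **Proposition.** Let $n>k\ge 0$. For every $F\in\mathcal F_{n,k}$ we have $\mathrm{parents}(F)-n+k+1\ge0$ and $\mathrm{wt}(F)=r^{\mathrm{niblings}(F)}s^{\mathrm{scindex}(F)}t^{\mathrm{parents}(F)-n+k+1}$, and $$\sum_{F\in\mathcal F_{n,k}} r^{\mathrm{niblings}(F)}\,s^{\mathrm{scindex}(F)}\,t^{\mathrm{parents}(F)-n+k+1}=\binom{n}{k}_r\,[k]_s\,([n]_t)^{n-k-1}.$$ In particular, for $r=s=t=q$, $$f_{n,k}(q)=\sum_{F\in\mathcal F_{n,k}}q^{\mathrm{niblings}(F)+\mathrm{scindex}(F)+\mathrm{parents}(F)-n+k+1}.$$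 Moreover $f_{n,k}(q)=\sum_{F\in\mathcal F_{n,k}}\mathrm{wt}_{q,q,q}(F)$ for all $n,k\ge 0$. All identities hold for arbitrary elements $r,s,t,q$ of any commutative ring, in particular as polynomial identities over $\mathbb Z$. -/

import Mathlib

/-- A forest of rooted labelled trees on `[n]`, given by its parent map: the element `v : Fin n` is
the vertex with label `v + 1`, `parent v = none` says that `v` is a root, `parent v = some u` says
that `u` is the parent of `v`, and no vertex is a proper ancestor of itself. -/
@[ext]
structure RootedForest (n : ℕ) where
  parent : Fin n → Option (Fin n)
  acyclic : ∀ v, ¬ Relation.TransGen (fun a b => parent a = some b) v v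

noncomputable instance (n : ℕ) : Fintype (RootedForest n) :=
  Fintype.ofInjective RootedForest.parent fun _ _ h => RootedForest.ext h

namespace RootedForest

/-- The set `V_r(F)` of roots. -/
def roots {n : ℕ} (F : RootedForest n) : Finset (Fin n) :=
  Finset.univ.filter fun v => F.parent v = none

/-- The underlying undirected graph. -/
def graph {n : ℕ} (F : RootedForest n) : SimpleGraph (Fin n) :=
  SimpleGraph.fromRel fun a b => F.parent a = some b

/-- The number of components of the forest. -/
noncomputable def components {n : ℕ} (F : RootedForest n) : ℕ :=
  Nat.card F.graph.ConnectedComponent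

/-- Each component contains exactly one root. -/
theorem components_eq_card_roots {n : ℕ} (F : RootedForest n) :
    F.components = F.roots.card := by
  have hadj : ∀ a b, F.parent a = some b → F.graph.Adj a b := by
    intro a b hab
    refine ⟨?_, Or.inl hab⟩
    rintro rfl
    exact F.acyclic a (Relation.TransGen.single hab)
  have hinv : ∀ a b ρ, F.parent ρ = none → F.graph.Adj a b →
      Relation.ReflTransGen (fun a b => F.parent a = some b) a ρ →
      Relation.ReflTransGen (fun a b => F.parent a = some b) b ρ := by
    intro a b ρ hρ hab h
    rcases hab.2 with h1 | h1
    · rcases h.cases_head with h2 | ⟨c, hc, h2⟩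
      · subst h2
        rw [hρ] at h1
        cases h1
      · have hcb : c = b := Option.some.inj (hc.symm.trans h1)
        exact hcb ▸ h2
    · exact Relation.ReflTransGen.head h1 h
  have hwf : WellFounded (fun b a : Fin n =>
      Relation.TransGen (fun a b => F.parent a = some b) a b) := by
    have : IsTrans (Fin n) (fun b a : Fin n =>
        Relation.TransGen (fun a b => F.parent a = some b) a b) :=
      ⟨fun _ _ _ h1 h2 => h2.trans h1⟩
    have : Std.Irrefl (fun b a : Fin n =>
        Relation.TransGen (fun a b => F.parent a = some b) a b) :=
      ⟨fun a => F.acyclic a⟩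
    exact Finite.wellFounded_of_trans_of_irrefl _
  have hex : ∀ v, ∃ ρ, F.parent ρ = none ∧ F.graph.Reachable ρ v := by
    intro v
    induction v using hwf.induction with
    | _ v ih =>
      cases hv : F.parent v with
      | none => exact ⟨v, hv, SimpleGraph.Reachable.refl v⟩
      | some u =>
        obtain ⟨ρ, hρ, h⟩ := ih u (Relation.TransGen.single hv)
        exact ⟨ρ, hρ, h.trans (hadj v u hv).symm.reachable⟩
  have hbij : Function.Bijective
      (fun ρ : F.roots => F.graph.connectedComponentMk ρ.1) := by
    constructor
    · rintro ⟨a, ha⟩ ⟨b, hb⟩ hab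
      have ha' : F.parent a = none := by simpa [roots] using ha
      have hb' : F.parent b = none := by simpa [roots] using hb
      obtain ⟨w⟩ := SimpleGraph.ConnectedComponent.exact hab
      have key : ∀ x y : Fin n, F.graph.Walk x y →
          Relation.ReflTransGen (fun a b => F.parent a = some b) x a →
          Relation.ReflTransGen (fun a b => F.parent a = some b) y a := by
        intro x y w
        induction w with
        | nil => exact id
        | cons h _ ih => exact fun hx => ih (hinv _ _ a ha' h hx)
      rcases (key a b w Relation.ReflTransGen.refl).cases_head with h2 | ⟨c, hc, _⟩
      · exact Subtype.ext h2.symm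
      · rw [hb'] at hc
        cases hc
    · intro c
      induction c using SimpleGraph.ConnectedComponent.ind with
      | _ v =>
        obtain ⟨ρ, hρ, h⟩ := hex v
        exact ⟨⟨ρ, by simpa [roots] using hρ⟩, SimpleGraph.ConnectedComponent.sound h⟩
  rw [components, ← Nat.card_eq_of_bijective _ hbij]
  simp

/-- The set `𝓕_{n,k}` of forests on `[n]` with `k` components. -/
noncomputable def withComponents (n k : ℕ) : Finset (RootedForest n) :=
  Finset.univ.filter fun F => F.components = k

/-- The label in `{1, …, n}` of the parent of `v` (and `0` if `v` is a root). -/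
def parentLabel {n : ℕ} (F : RootedForest n) (v : Fin n) : ℕ :=
  (F.parent v).elim 0 fun u => (u : ℕ) + 1

/-- `V_r(F, v)`: the nonroot vertices that are lower-numbered than `v`. -/
def lowerNonroots {n : ℕ} (F : RootedForest n) (v : Fin n) : Finset (Fin n) :=
  Finset.univ.filter fun w => w ∉ F.roots ∧ w < v

/-- `niblings(F)`. -/
def niblings {n : ℕ} (F : RootedForest n) : ℕ :=
  ∑ v ∈ F.roots, (F.lowerNonroots v).card

/-- The vertices whose parent is a root. -/
def rootChildren {n : ℕ} (F : RootedForest n) : Finset (Fin n) :=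
  Finset.univ.filter fun v => ∃ u ∈ F.roots, F.parent v = some u

/-- `V_s(F)`: the set `{v_min}`, where `v_min` is the lowest-numbered vertex among all children of
roots; it is empty when every vertex is a root. -/
def minRootChild {n : ℕ} (F : RootedForest n) : Finset (Fin n) :=
  F.rootChildren.filter fun v => ∀ w ∈ F.rootChildren, v ≤ w

/-- `V_t(F)`: the vertices that are neither a root nor `v_min`. -/
def otherVertices {n : ℕ} (F : RootedForest n) : Finset (Fin n) :=
  Finset.univ.filter fun v => v ∉ F.roots ∧ v ∉ F.minRootChild

/-- `scindex(F)`: if `v_0 < v_1 < ⋯ < v_{k-1}` are the roots, the `j` for which `v_j` is the parent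
of `v_min`, that is, the number of roots that are lower-numbered than this parent. (The outer sum
has only the term `v = v_min`, and none if `v_min` does not exist.) -/
def scindex {n : ℕ} (F : RootedForest n) : ℕ :=
  ∑ v ∈ F.minRootChild, (F.roots.filter fun u : Fin n => (u : ℕ) + 1 < F.parentLabel v).card

/-- `parents(F)`: the sum of the labels of the parents of the vertices in `V_t(F)`. -/
def parents {n : ℕ} (F : RootedForest n) : ℕ :=
  ∑ v ∈ F.otherVertices, F.parentLabel v

/-- The weight of a vertex. -/
def vertexWeight {R : Type*} [CommRing R] {n : ℕ} (r s t : R) (F : RootedForest n)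
    (v : Fin n) : R :=
  if v ∈ F.roots then r ^ (F.lowerNonroots v).card
  else if v ∈ F.minRootChild then s ^ F.scindex
  else t ^ (F.parentLabel v - 1)

/-- The weight of a forest: the product of the weights of its vertices. -/
def weight {R : Type*} [CommRing R] {n : ℕ} (r s t : R) (F : RootedForest n) : R :=
  ∏ v, F.vertexWeight r s t v

end RootedForest

/-- `[n]_q = 1 + q + ⋯ + q^(n-1)`. -/
def qNumber {R : Type*} [CommRing R] (q : R) (n : ℕ) : R :=
  ∑ i ∈ Finset.range n, q ^ i

/-- `[n]_q! = [1]_q [2]_q ⋯ [n]_q`. -/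
def qFactorial {R : Type*} [CommRing R] (q : R) (n : ℕ) : R :=
  ∏ j ∈ Finset.range n, qNumber q (j + 1)

/-- The `q`-binomial coefficient `[n]_q! / ([k]_q! [n-k]_q!)` as a polynomial in `q`, for `k ≤ n`;
the denominator is monic and divides the numerator in `ℤ[q]`. -/
noncomputable def qBinomialPoly (n k : ℕ) : Polynomial ℤ :=
  qFactorial Polynomial.X n /ₘ (qFactorial Polynomial.X k * qFactorial Polynomial.X (n - k))

theorem qFactorial_X_monic (n : ℕ) : (qFactorial (Polynomial.X : Polynomial ℤ) n).Monic :=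
  Polynomial.monic_prod_of_monic _ _ fun _ _ => Polynomial.monic_geom_sum_X (Nat.succ_ne_zero _)

/-- The division in the definition of the `q`-binomial coefficient is exact. -/
theorem qBinomialPoly_mul {n k : ℕ} (h : k ≤ n) :
    qBinomialPoly n k * (qFactorial Polynomial.X k * qFactorial Polynomial.X (n - k)) =
      qFactorial Polynomial.X n := by
  have hdvd : ∀ a b : ℕ, qFactorial (Polynomial.X : Polynomial ℤ) a * qFactorial Polynomial.X b ∣
      qFactorial Polynomial.X (a + b) := by
    have hsucc : ∀ m, qFactorial (Polynomial.X : Polynomial ℤ) (m + 1) =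
        qFactorial Polynomial.X m * qNumber Polynomial.X (m + 1) := fun m =>
      Finset.prod_range_succ _ _
    intro a
    induction a with
    | zero => intro b; simp [qFactorial]
    | succ a iha =>
      intro b
      induction b with
      | zero => simp [qFactorial]
      | succ b ihb =>
        have hsum : qNumber (Polynomial.X : Polynomial ℤ) (a + 1 + (b + 1)) =
            qNumber Polynomial.X (a + 1) +
              Polynomial.X ^ (a + 1) * qNumber Polynomial.X (b + 1) := by
          rw [qNumber, Finset.sum_range_add, qNumber, qNumber, Finset.mul_sum]
          simp only [pow_add]
        obtain ⟨c, hc⟩ := iha (b + 1)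
        obtain ⟨d, hd⟩ := ihb
        have e1 : a + (b + 1) = a + 1 + b := by ring
        rw [e1] at hc
        refine ⟨c + Polynomial.X ^ (a + 1) * d, ?_⟩
        rw [show a + 1 + (b + 1) = (a + 1 + b) + 1 by ring, hsucc (a + 1 + b),
          show a + 1 + b + 1 = a + 1 + (b + 1) by ring, hsum, mul_add]
        nth_rewrite 1 [hc]
        rw [hd, hsucc a, hsucc b]
        ring
  have hm := (qFactorial_X_monic k).mul (qFactorial_X_monic (n - k))
  have hd := hdvd k (n - k)
  rw [Nat.add_sub_cancel' h] at hd
  have h1 := Polynomial.modByMonic_add_div (qFactorial (Polynomial.X : Polynomial ℤ) n)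
    (qFactorial Polynomial.X k * qFactorial Polynomial.X (n - k))
  rw [(Polynomial.modByMonic_eq_zero_iff_dvd hm).2 hd, zero_add] at h1
  rw [mul_comm]
  exact h1

/-- The `q`-binomial coefficient, for `q` in a commutative ring. -/
noncomputable def qBinomial {R : Type*} [CommRing R] (q : R) (n k : ℕ) : R :=
  Polynomial.aeval q (qBinomialPoly n k)

/-- The `(n, k)` entry `f_{n,k}(q)` of the `q`-forests matrix. -/
noncomputable def qForestsEntry {R : Type*} [CommRing R] (q : R) (n k : ℕ) : R :=
  if k = 0 then (if n = k then 1 else 0)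
  else if k ≤ n then qBinomial q (n - 1) (k - 1) * qNumber q n ^ (n - k)
  else 0

/-!
Deleting the roots of a forest leaves a forest whose roots are the children of the old roots. Write
`x(A)` for the sum over `A` of the weights `x u`. If a nonroot vertex with parent `u` has weight
`x u`, then summing over the set `C` of children of roots and over all ways of attaching `C` to the
root set `S` shows by induction that the forests with root set `S` and nonroot set `T ≠ ∅` have
total weight `x(S) * (x(S) + x(T)) ^ (#T - 1)`. Reweighting the edge above the least element of `C`
by the index of its upper end among the roots replaces one factor `x(S)` by `[#S]_s` for each `C`,
so the total weight becomes `[#S]_s * (x(S) + x(T)) ^ (#T - 1)`; with `x u = t ^ u` the sum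
`x(S) + x(T)` is `[n]_t`. The exponent `niblings` counts inversions of the root set, whose
generating function over the `k`-element subsets of `[n]` is the `r`-binomial coefficient.
-/

section SubsetSums

open Finset

variable {α M : Type*} [AddCommMonoid M]

theorem sum_powersetCard_succ_insert [DecidableEq α] {A : Finset α} {a : α} (ha : a ∉ A) (k : ℕ)
    (f : Finset α → M) :
    ∑ S ∈ (insert a A).powersetCard (k + 1), f S =
      ∑ S ∈ A.powersetCard (k + 1), f S + ∑ S ∈ A.powersetCard k, f (insert a S) := by
  rw [powersetCard_succ_insert ha, sum_union, sum_image]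
  · exact insert_erase_invOn.2.injOn.mono fun S hS => notMem_mono (mem_powersetCard.1 hS).1 ha
  · rw [disjoint_left]
    grind

theorem sum_powersetCard_sum (T : Finset α) (x : α → M) (c : ℕ) :
    ∑ C ∈ T.powersetCard (c + 1), ∑ v ∈ C, x v = (#T - 1).choose c • ∑ v ∈ T, x v := by
  classical
  have card_containing : ∀ v ∈ T, #{C ∈ T.powersetCard (c + 1) | v ∈ C} = (#T - 1).choose c := by
    intro v hv
    simpa using card_filter_powersetCard_subset {v} T (c + 1) (singleton_subset_iff.2 hv) (by simp)
  calc ∑ C ∈ T.powersetCard (c + 1), ∑ v ∈ C, x v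
      = ∑ v ∈ T, ∑ C ∈ T.powersetCard (c + 1) with v ∈ C, x v :=
        sum_comm' (by grind)
    _ = (#T - 1).choose c • ∑ v ∈ T, x v := by
        rw [smul_sum]
        exact sum_congr rfl fun v hv => by rw [sum_const, card_containing v hv]

end SubsetSums

section QAnalogues

open Finset

variable {R : Type*} [CommRing R] (q : R)

theorem qNumber_add (a b : ℕ) : qNumber q (a + b) = qNumber q a + q ^ a * qNumber q b := by
  simp only [qNumber, sum_range_add, mul_sum, pow_add]

theorem qFactorial_zero : qFactorial q 0 = 1 :=
  prod_range_zero _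

theorem qFactorial_succ (n : ℕ) : qFactorial q (n + 1) = qFactorial q n * qNumber q (n + 1) :=
  prod_range_succ _ _

theorem qBinomialPoly_eq_of_mul {n k : ℕ} (h : k ≤ n) {P : Polynomial ℤ}
    (hP : P * (qFactorial Polynomial.X k * qFactorial Polynomial.X (n - k)) =
      qFactorial Polynomial.X n) : qBinomialPoly n k = P :=
  mul_right_cancel₀ ((qFactorial_X_monic k).mul (qFactorial_X_monic (n - k))).ne_zero
    ((qBinomialPoly_mul h).trans hP.symm)

theorem qBinomial_self (n : ℕ) : qBinomial q n n = 1 := by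
  rw [qBinomial, qBinomialPoly_eq_of_mul le_rfl (P := 1) (by simp [qFactorial_zero]), map_one]

theorem qBinomial_succ_mul_qNumber {n k : ℕ} (h : k ≤ n) :
    qBinomial q (n + 1) (k + 1) * qNumber q (k + 1) = qBinomial q n k * qNumber q (n + 1) := by
  have key : qBinomialPoly (n + 1) (k + 1) * qNumber Polynomial.X (k + 1) =
      qBinomialPoly n k * qNumber Polynomial.X (n + 1) := by
    refine mul_right_cancel₀ ((qFactorial_X_monic k).mul (qFactorial_X_monic (n - k))).ne_zero ?_
    have h₁ := qBinomialPoly_mul (Nat.add_le_add_right h 1)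
    have h₀ := qBinomialPoly_mul h
    rw [Nat.add_sub_add_right, qFactorial_succ, qFactorial_succ] at h₁
    linear_combination h₁ - qNumber Polynomial.X (n + 1) * h₀
  simpa [qBinomial, qNumber] using congrArg (Polynomial.aeval q) key

theorem qForestsEntry_self (n : ℕ) : qForestsEntry q n n = 1 := by
  rcases eq_or_ne n 0 with rfl | h
  · simp [qForestsEntry]
  · rw [qForestsEntry, if_neg h, if_pos le_rfl, qBinomial_self, Nat.sub_self, pow_zero, mul_one]

theorem qForestsEntry_of_lt {n k : ℕ} (hk : k < n) :
    qForestsEntry q n k = qBinomial q n k * qNumber q k * qNumber q n ^ (n - k - 1) := by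
  cases k with
  | zero => simp [qForestsEntry, qNumber, hk.ne']
  | succ k =>
    obtain ⟨e, rfl⟩ := Nat.exists_eq_add_of_lt hk
    rw [qForestsEntry, if_neg k.succ_ne_zero, if_pos hk.le, qBinomial_succ_mul_qNumber q (by lia),
      show k + 1 + e + 1 - (k + 1) = e + 1 by lia, Nat.add_sub_cancel, Nat.add_sub_cancel,
      Nat.add_sub_cancel, pow_succ']
    ring

variable {α : Type*} [LinearOrder α]

theorem sum_pow_card_filter_lt (A : Finset α) : ∑ u ∈ A, q ^ #{w ∈ A | w < u} = qNumber q #A := by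
  induction A using Finset.induction_on_max with
  | empty => simp [qNumber]
  | insert a A ha ih =>
    have haA : a ∉ A := fun h => lt_irrefl a (ha a h)
    have below_of_mem : ∀ u ∈ A, {w ∈ insert a A | w < u} = {w ∈ A | w < u} := fun u hu => by
      rw [filter_insert, if_neg (ha u hu).not_gt]
    have below_max : {w ∈ insert a A | w < a} = A := by
      rw [filter_insert, if_neg (lt_irrefl a), filter_true_of_mem ha]
    rw [sum_insert haA, below_max, sum_congr rfl fun u hu => by rw [below_of_mem u hu], ih,
      card_insert_of_notMem haA, qNumber, qNumber, sum_range_succ, add_comm]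

/-- The inversion generating function of the `k`-element subsets of `A`: an inversion of `S` is a
pair of an element of `S` and a smaller element of `A \ S`. -/
def inversionSum (A : Finset α) (k : ℕ) : R :=
  ∑ S ∈ A.powersetCard k, q ^ ∑ v ∈ S, #{w ∈ A \ S | w < v}

theorem inversionSum_zero (A : Finset α) : inversionSum q A 0 = 1 := by
  simp [inversionSum]

theorem inversionSum_card (A : Finset α) : inversionSum q A #A = 1 := by
  simp [inversionSum]

theorem inversionSum_insert {A : Finset α} {a : α} (ha : ∀ x ∈ A, x < a) (k : ℕ) :
    inversionSum q (insert a A) (k + 1) =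
      inversionSum q A (k + 1) + q ^ (#A - k) * inversionSum q A k := by
  have haA : a ∉ A := fun h => lt_irrefl a (ha a h)
  rw [inversionSum, sum_powersetCard_succ_insert haA, inversionSum, inversionSum, mul_sum]
  congr 1 <;> refine sum_congr rfl fun S hS => ?_ <;> obtain ⟨hSA, hcard⟩ := mem_powersetCard.1 hS
  · congr 1
    refine sum_congr rfl fun v hv => ?_
    rw [insert_sdiff_of_notMem A (notMem_mono hSA haA), filter_insert,
      if_neg (ha v (hSA hv)).not_gt]
  · have hsdiff : insert a A \ insert a S = A \ S := by grind
    have below_max : {w ∈ A \ S | w < a} = A \ S :=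
      filter_true_of_mem fun w hw => ha w (mem_sdiff.1 hw).1
    rw [hsdiff, sum_insert (notMem_mono hSA haA), below_max, card_sdiff_of_subset hSA, hcard,
      pow_add]

theorem inversionSum_mul_qFactorial (A : Finset α) :
    ∀ {k m : ℕ}, #A = k + m →
      inversionSum q A k * (qFactorial q k * qFactorial q m) = qFactorial q #A := by
  induction A using Finset.induction_on_max with
  | empty =>
    intro k m h
    obtain ⟨rfl, rfl⟩ := Nat.add_eq_zero_iff.1 h.symm
    simp [inversionSum_zero, qFactorial_zero]
  | insert a A ha ih =>
    intro k m h
    match k, m with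
    | 0, m => simp [inversionSum_zero, qFactorial_zero, h]
    | k, 0 => rw [← h.trans (add_zero k), inversionSum_card, qFactorial_zero, one_mul, mul_one]
    | k + 1, m + 1 =>
      rw [card_insert_of_notMem fun h => lt_irrefl a (ha a h)] at h ⊢
      have avoiding_max := ih (k := k + 1) (m := m) (by lia)
      have containing_max := ih (k := k) (m := m + 1) (by lia)
      have hsplit := qNumber_add q (m + 1) (k + 1)
      rw [show m + 1 + (k + 1) = #A + 1 by lia] at hsplit
      rw [inversionSum_insert q ha, show #A - k = m + 1 by lia, qFactorial_succ q #A, hsplit]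
      simp only [qFactorial_succ] at avoiding_max containing_max ⊢
      linear_combination qNumber q (m + 1) * avoiding_max +
        q ^ (m + 1) * qNumber q (k + 1) * containing_max

theorem inversionSum_eq_qBinomial (A : Finset α) {k : ℕ} (hk : k ≤ #A) :
    inversionSum q A k = qBinomial q #A k := by
  rw [qBinomial, qBinomialPoly_eq_of_mul hk
    (inversionSum_mul_qFactorial Polynomial.X A (Nat.add_sub_cancel' hk).symm)]
  simp [inversionSum]

end QAnalogues

section ForestEnumerator

open Finset

variable {V R : Type*} [CommSemiring R] [DecidableEq V] (x : V → R)

/-- The closed form of the weight enumerator of the forests with root set `S` and nonroot set `T`,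
where a nonroot vertex with parent `u` has weight `x u`. -/
def forestEnumerator (S T : Finset V) : R :=
  if T = ∅ then 1 else (∑ u ∈ S, x u) * (∑ u ∈ S, x u + ∑ u ∈ T, x u) ^ (#T - 1)

theorem sum_powersetCard_forestEnumerator {T : Finset V} {c : ℕ} (hc : c < #T) :
    ∑ C ∈ T.powersetCard (c + 1), forestEnumerator x C (T \ C) =
      (#T - 1).choose c • (∑ u ∈ T, x u) ^ (#T - 1 - c) := by
  rcases (Nat.le_sub_one_of_lt hc).eq_or_lt with rfl | hlt
  · rw [Nat.sub_add_cancel (by lia)]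
    simp [forestEnumerator]
  · have enumerator_eq : ∀ C ∈ T.powersetCard (c + 1), forestEnumerator x C (T \ C) =
        (∑ u ∈ C, x u) * (∑ u ∈ T, x u) ^ (#T - 1 - c - 1) := by
      intro C hC
      obtain ⟨hCT, hcard⟩ := mem_powersetCard.1 hC
      have hcard' : #(T \ C) = #T - 1 - c := by rw [card_sdiff_of_subset hCT]; lia
      have hne : T \ C ≠ ∅ := (card_pos.1 (by lia)).ne_empty
      rw [forestEnumerator, if_neg hne, hcard', add_comm, sum_sdiff hCT]
    rw [sum_congr rfl enumerator_eq, ← sum_mul, sum_powersetCard_sum, smul_mul_assoc, ← pow_succ',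
      Nat.sub_add_cancel (by lia)]

theorem sum_pow_mul_forestEnumerator (a : R) {T : Finset V} (hT : T.Nonempty) :
    ∑ c ∈ range #T, ∑ C ∈ T.powersetCard (c + 1), a ^ c * forestEnumerator x C (T \ C) =
      (a + ∑ u ∈ T, x u) ^ (#T - 1) := by
  rw [add_pow, Nat.sub_add_cancel hT.card_pos]
  refine sum_congr rfl fun c hc => ?_
  rw [← mul_sum, sum_powersetCard_forestEnumerator x (mem_range.1 hc), nsmul_eq_mul]
  ring

end ForestEnumerator

section ForestWeight

open Finset

variable {V R : Type*} [Fintype V] [CommMonoid R]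

/-- The product of the weights `w v u` of all edges from a vertex `v` to its parent `u`. -/
def forestWeight (w : V → V → R) (p : V → Option V) : R :=
  ∏ v, (p v).elim 1 (w v)

theorem forestWeight_congr {w w' : V → V → R} {p : V → Option V}
    (h : ∀ v u, p v = some u → w v u = w' v u) : forestWeight w p = forestWeight w' p := by
  refine prod_congr rfl fun v _ => ?_
  cases hv : p v with
  | none => rfl
  | some u => exact h v u hv

theorem forestWeight_piecewise [DecidableEq V] (w : V → V → R) {C : Finset V} {f g : V → Option V}
    (hf : ∀ v ∉ C, f v = none) (hg : ∀ v ∈ C, g v = none) :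
    forestWeight w (C.piecewise f g) = forestWeight w f * forestWeight w g := by
  simp only [forestWeight, ← prod_mul_distrib]
  refine prod_congr rfl fun v _ => ?_
  by_cases hv : v ∈ C
  · simp [hv, hg v hv]
  · simp [hv, hf v hv]

end ForestWeight

section ForestMaps

open Finset

variable {V : Type*} [DecidableEq V]

/-- `p` is the parent map of a forest on the vertex set `S ∪ T` with root set `S`. The value `none`
is taken at the roots and also outside the vertex set; acyclicity is well-foundedness of the
relation "`u` is the parent of `v`". -/
structure IsForestMap (S T : Finset V) (p : V → Option V) : Prop where
  eq_none_iff : ∀ v, p v = none ↔ v ∉ T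
  parent_mem : ∀ {v u}, p v = some u → u ∈ S ∪ T
  wellFounded : WellFounded fun u v => p v = some u

theorem IsForestMap.mem_of_parent {S T : Finset V} {p : V → Option V} (hp : IsForestMap S T p)
    {v u : V} (h : p v = some u) : v ∈ T :=
  not_not.1 fun hv => Option.some_ne_none u (h ▸ (hp.eq_none_iff v).2 hv)

variable [Fintype V]

/-- The vertices whose parent lies in `S`. -/
def childrenOf (S : Finset V) (p : V → Option V) : Finset V :=
  {v | ∃ u ∈ S, p v = some u}

@[simp]
theorem mem_childrenOf {S : Finset V} {p : V → Option V} {v : V} :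
    v ∈ childrenOf S p ↔ ∃ u ∈ S, p v = some u := by
  simp [childrenOf]

theorem IsForestMap.childrenOf_subset {S T : Finset V} {p : V → Option V}
    (hp : IsForestMap S T p) : childrenOf S p ⊆ T := by
  intro v hv
  obtain ⟨u, -, hu⟩ := mem_childrenOf.1 hv
  exact hp.mem_of_parent hu

theorem IsForestMap.childrenOf_nonempty {S T : Finset V} {p : V → Option V}
    (hp : IsForestMap S T p) (hT : T.Nonempty) : (childrenOf S p).Nonempty := by
  obtain ⟨v, hvT, hmin⟩ := hp.wellFounded.has_min (T : Set V) hT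
  obtain ⟨u, hu⟩ := Option.ne_none_iff_exists'.1 fun h => (hp.eq_none_iff v).1 h hvT
  have huS : u ∈ S := (mem_union.1 (hp.parent_mem hu)).resolve_right fun huT => hmin u huT hu
  exact ⟨v, mem_childrenOf.2 ⟨u, huS, hu⟩⟩

/-- The partial maps that attach every vertex of `C` to some vertex of `S`. -/
def childMaps (S C : Finset V) : Finset (V → Option V) :=
  Fintype.piFinset fun v => if v ∈ C then S.map Function.Embedding.some else {none}

theorem mem_childMaps {S C : Finset V} {f : V → Option V} :
    f ∈ childMaps S C ↔ (∀ v ∈ C, ∃ u ∈ S, f v = some u) ∧ ∀ v ∉ C, f v = none := by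
  rw [childMaps, Fintype.mem_piFinset, ← forall_and]
  refine forall_congr' fun v => ?_
  by_cases hv : v ∈ C <;> simp [hv, eq_comm]

theorem piecewise_none_mem_childMaps (S : Finset V) (p : V → Option V) :
    (childrenOf S p).piecewise p (fun _ => none) ∈ childMaps S (childrenOf S p) := by
  refine mem_childMaps.2 ⟨fun v hv => ?_, fun v hv => piecewise_eq_of_notMem _ _ _ hv⟩
  rw [piecewise_eq_of_mem _ _ _ hv]
  exact mem_childrenOf.1 hv

theorem IsForestMap.none_piecewise {S T : Finset V} {p : V → Option V} (hp : IsForestMap S T p) :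
    IsForestMap (childrenOf S p) (T \ childrenOf S p)
      ((childrenOf S p).piecewise (fun _ => none) p) := by
  have parent_eq : ∀ {v u}, (childrenOf S p).piecewise (fun _ => none) p v = some u →
      v ∉ childrenOf S p ∧ p v = some u := by
    intro v u h
    by_cases hv : v ∈ childrenOf S p
    · simp [piecewise_eq_of_mem _ _ _ hv] at h
    · exact ⟨hv, (piecewise_eq_of_notMem _ _ _ hv).symm.trans h⟩
  refine ⟨fun v => ?_, fun {v u} h => ?_, Subrelation.wf (fun h => (parent_eq h).2) hp.wellFounded⟩
  · by_cases hv : v ∈ childrenOf S p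
    · simp only [piecewise_eq_of_mem _ _ _ hv, mem_sdiff, hv, not_true, and_false, not_false_iff]
    · simp only [piecewise_eq_of_notMem _ _ _ hv, hp.eq_none_iff, mem_sdiff, hv, not_false_iff,
        and_true]
  · obtain ⟨hv, hvu⟩ := parent_eq h
    rw [union_sdiff_of_subset hp.childrenOf_subset]
    exact (mem_union.1 (hp.parent_mem hvu)).resolve_left fun hu =>
      hv (mem_childrenOf.2 ⟨u, hu, hvu⟩)

section Attach

variable {S T C : Finset V} {f g : V → Option V}

theorem childrenOf_piecewise (hST : Disjoint S T) (hCT : C ⊆ T) (hf : f ∈ childMaps S C)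
    (hg : IsForestMap C (T \ C) g) : childrenOf S (C.piecewise f g) = C := by
  ext v
  by_cases hv : v ∈ C
  · simpa [hv] using (mem_childMaps.1 hf).1 v hv
  · simp only [mem_childrenOf, piecewise_eq_of_notMem _ _ _ hv, hv, iff_false]
    rintro ⟨u, huS, hu⟩
    have huT := hg.parent_mem hu
    rw [union_sdiff_of_subset hCT] at huT
    exact disjoint_left.1 hST huS huT

theorem wellFounded_piecewise (hST : Disjoint S T) (hCT : C ⊆ T) (hf : f ∈ childMaps S C)
    (hg : IsForestMap C (T \ C) g) : WellFounded fun u v => C.piecewise f g v = some u := by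
  have acc_root : ∀ v ∈ S, Acc (fun u v => C.piecewise f g v = some u) v := by
    intro v hv
    have hvT := disjoint_left.1 hST hv
    have hnone : C.piecewise f g v = none := by
      rw [piecewise_eq_of_notMem _ _ _ (notMem_mono hCT hvT), hg.eq_none_iff]
      exact notMem_mono sdiff_subset hvT
    exact ⟨v, fun u hu => by simp [hnone] at hu⟩
  have acc_child : ∀ v ∈ C, Acc (fun u v => C.piecewise f g v = some u) v := by
    intro v hv
    obtain ⟨u, huS, hu⟩ := (mem_childMaps.1 hf).1 v hv
    refine ⟨v, fun u' hu' => acc_root u' ?_⟩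
    rw [piecewise_eq_of_mem _ _ _ hv, hu, Option.some_inj] at hu'
    exact hu' ▸ huS
  refine ⟨fun v => hg.wellFounded.induction v fun v ih => ?_⟩
  by_cases hv : v ∈ C
  · exact acc_child v hv
  · exact ⟨v, fun u hu => ih u (by rwa [piecewise_eq_of_notMem _ _ _ hv] at hu)⟩

theorem IsForestMap.piecewise (hST : Disjoint S T) (hCT : C ⊆ T) (hf : f ∈ childMaps S C)
    (hg : IsForestMap C (T \ C) g) : IsForestMap S T (C.piecewise f g) := by
  refine ⟨fun v => ?_, fun {v u} h => ?_, wellFounded_piecewise hST hCT hf hg⟩ <;>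
    by_cases hv : v ∈ C
  · obtain ⟨u, -, hu⟩ := (mem_childMaps.1 hf).1 v hv
    simp [hv, hu, hCT hv]
  · simp [hv, hg.eq_none_iff]
  · obtain ⟨u', hu'S, hu'⟩ := (mem_childMaps.1 hf).1 v hv
    rw [piecewise_eq_of_mem _ _ _ hv, hu', Option.some_inj] at h
    exact mem_union_left T (h ▸ hu'S)
  · rw [piecewise_eq_of_notMem _ _ _ hv] at h
    rw [← union_sdiff_of_subset hCT]
    exact mem_union_right S (hg.parent_mem h)

end Attach

section Weights

variable {R : Type*} [CommSemiring R]

theorem sum_childMaps_forestWeight (S C : Finset V) (w : V → V → R) :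
    ∑ f ∈ childMaps S C, forestWeight w f = ∏ v ∈ C, ∑ u ∈ S, w v u := by
  simp only [childMaps, forestWeight]
  rw [← prod_univ_sum (fun v => if v ∈ C then S.map .some else {none}) fun v o => o.elim 1 (w v),
    ← prod_subset (subset_univ C) fun v _ hv => by simp [hv]]
  exact prod_congr rfl fun v hv => by simp [hv]

open Classical in
/-- The parent maps of the forests on `S ∪ T` with root set `S`. -/
noncomputable def forestMaps (S T : Finset V) : Finset (V → Option V) :=
  {p | IsForestMap S T p}

@[simp]
theorem mem_forestMaps {S T : Finset V} {p : V → Option V} :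
    p ∈ forestMaps S T ↔ IsForestMap S T p := by
  simp [forestMaps]

theorem forestMaps_empty (S : Finset V) : forestMaps S ∅ = {fun _ => none} := by
  ext p
  rw [mem_forestMaps, mem_singleton]
  refine ⟨fun hp => funext fun v => (hp.eq_none_iff v).2 (notMem_empty v), ?_⟩
  rintro rfl
  exact ⟨by simp, by simp, ⟨fun v => ⟨v, by simp⟩⟩⟩

theorem sum_forestWeight_filter_childrenOf {S T C : Finset V} (hST : Disjoint S T) (hCT : C ⊆ T)
    (w : V → V → R) :
    ∑ p ∈ forestMaps S T with childrenOf S p = C, forestWeight w p =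
      (∏ v ∈ C, ∑ u ∈ S, w v u) * ∑ p ∈ forestMaps C (T \ C), forestWeight w p := by
  have eq_none_on {g : V → Option V} (hg : IsForestMap C (T \ C) g) : ∀ v ∈ C, g v = none :=
    fun v hv => (hg.eq_none_iff v).2 fun h => (mem_sdiff.1 h).2 hv
  rw [← sum_childMaps_forestWeight, sum_mul_sum, ← sum_product']
  refine (sum_bij' (fun fg _ => C.piecewise fg.1 fg.2)
    (fun p _ => (C.piecewise p fun _ => none, C.piecewise (fun _ => none) p)) ?_ ?_ ?_ ?_ ?_).symm
  · rintro ⟨f, g⟩ hfg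
    obtain ⟨hf, hg⟩ := mem_product.1 hfg
    rw [mem_forestMaps] at hg
    exact mem_filter.2
      ⟨mem_forestMaps.2 (hg.piecewise hST hCT hf), childrenOf_piecewise hST hCT hf hg⟩
  · intro p hp
    obtain ⟨hpST, rfl⟩ := mem_filter.1 hp
    exact mem_product.2 ⟨piecewise_none_mem_childMaps S p,
      mem_forestMaps.2 (mem_forestMaps.1 hpST).none_piecewise⟩
  · rintro ⟨f, g⟩ hfg
    obtain ⟨hf, hg⟩ := mem_product.1 hfg
    have hf₀ : ∀ v ∉ C, none = f v := fun v hv => ((mem_childMaps.1 hf).2 v hv).symm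
    have hg₀ : ∀ v ∈ C, none = g v := fun v hv => (eq_none_on (mem_forestMaps.1 hg) v hv).symm
    exact Prod.ext
      ((piecewise_idem_left ..).trans ((C.piecewise_congr (fun _ _ => rfl) hf₀).trans
        (C.piecewise_same f)))
      ((piecewise_idem_right ..).trans ((C.piecewise_congr hg₀ fun _ _ => rfl).trans
        (C.piecewise_same g)))
  · intro p _
    exact (piecewise_idem_left ..).trans ((piecewise_idem_right ..).trans (C.piecewise_same p))
  · rintro ⟨f, g⟩ hfg
    obtain ⟨hf, hg⟩ := mem_product.1 hfg
    exact (forestWeight_piecewise w (mem_childMaps.1 hf).2 (eq_none_on (mem_forestMaps.1 hg))).symm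

theorem sum_forestMaps_eq_sum_powersetCard {M : Type*} [AddCommMonoid M] (S : Finset V)
    {T : Finset V} (hT : T.Nonempty) (F : (V → Option V) → M) :
    ∑ p ∈ forestMaps S T, F p = ∑ c ∈ range #T, ∑ C ∈ T.powersetCard (c + 1),
      ∑ p ∈ forestMaps S T with childrenOf S p = C, F p := by
  have no_childless : {p ∈ forestMaps S T | childrenOf S p = ∅} = ∅ :=
    filter_eq_empty_iff.2 fun p hp => ((mem_forestMaps.1 hp).childrenOf_nonempty hT).ne_empty
  have maps_to : ∀ p ∈ forestMaps S T, childrenOf S p ∈ T.powerset := fun p hp =>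
    mem_powerset.2 (mem_forestMaps.1 hp).childrenOf_subset
  rw [← sum_fiberwise_of_maps_to maps_to, sum_powerset, sum_range_succ', powersetCard_zero,
    sum_singleton, no_childless, sum_empty, add_zero]

theorem sum_forestWeight_eq_forestEnumerator (x : V → R) {S T : Finset V} (hST : Disjoint S T) :
    ∑ p ∈ forestMaps S T, forestWeight (fun _ => x) p = forestEnumerator x S T := by
  induction T using Finset.strongInduction generalizing S with
  | H T ih =>
    rcases T.eq_empty_or_nonempty with rfl | hT
    · simp [forestMaps_empty, forestEnumerator, forestWeight]
    · rw [sum_forestMaps_eq_sum_powersetCard S hT, forestEnumerator, if_neg hT.ne_empty,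
        ← sum_pow_mul_forestEnumerator x _ hT, mul_sum]
      refine sum_congr rfl fun c _ => ?_
      rw [mul_sum]
      refine sum_congr rfl fun C hC => ?_
      obtain ⟨hCT, hcard⟩ := mem_powersetCard.1 hC
      have hCne : C.Nonempty := card_pos.1 (by lia)
      rw [sum_forestWeight_filter_childrenOf hST hCT,
        ih (T \ C) (sdiff_ssubset hCT hCne) disjoint_sdiff, prod_const, hcard, pow_succ', mul_assoc]

end Weights

end ForestMaps

section ScindexWeight

open Finset

variable {V R : Type*} [LinearOrder V]

/-- The weight of an edge from `v` to its parent `u` in a forest with root set `S` in which `C` is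
the set of children of roots: the least element of `C` is weighted by the index of its parent among
the roots, every other vertex by `x u`. -/
def scindexWeight [Monoid R] (s : R) (x : V → R) (S C : Finset V) (v u : V) : R :=
  if v ∈ C ∧ ∀ w ∈ C, v ≤ w then s ^ #{w ∈ S | w < u} else x u

variable [CommRing R] (s : R) (x : V → R)

theorem prod_sum_scindexWeight (S : Finset V) {C : Finset V} (hC : C.Nonempty) :
    ∏ v ∈ C, ∑ u ∈ S, scindexWeight s x S C v u =
      qNumber s #S * (∑ u ∈ S, x u) ^ (#C - 1) := by
  have hmin := C.isLeast_min' hC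
  rw [← mul_prod_erase C _ hmin.1, ← card_erase_of_mem hmin.1, ← prod_const]
  congr 1
  · rw [← sum_pow_card_filter_lt]
    exact sum_congr rfl fun u _ => if_pos ⟨hmin.1, fun w hw => hmin.2 hw⟩
  · refine prod_congr rfl fun v hv => sum_congr rfl fun u _ => if_neg fun hleast => ?_
    exact ne_of_mem_erase hv ((hleast.2 _ hmin.1).antisymm (hmin.2 hleast.1))

theorem sum_forestWeight_scindexWeight [Fintype V] {S T : Finset V} (hST : Disjoint S T)
    (hT : T.Nonempty) :
    ∑ p ∈ forestMaps S T, forestWeight (scindexWeight s x S (childrenOf S p)) p =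
      qNumber s #S * (∑ u ∈ S, x u + ∑ u ∈ T, x u) ^ (#T - 1) := by
  rw [sum_forestMaps_eq_sum_powersetCard S hT, ← sum_pow_mul_forestEnumerator x _ hT, mul_sum]
  refine sum_congr rfl fun c _ => ?_
  rw [mul_sum]
  refine sum_congr rfl fun C hC => ?_
  obtain ⟨hCT, hcard⟩ := mem_powersetCard.1 hC
  have hCne : C.Nonempty := card_pos.1 (by lia)
  have fixed_children : ∀ p ∈ {p ∈ forestMaps S T | childrenOf S p = C},
      forestWeight (scindexWeight s x S (childrenOf S p)) p =
        forestWeight (scindexWeight s x S C) p := fun p hp => by rw [(mem_filter.1 hp).2]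
  have away_from_children : ∀ p ∈ forestMaps C (T \ C),
      forestWeight (scindexWeight s x S C) p = forestWeight (fun _ => x) p := by
    intro p hp
    refine forestWeight_congr fun v u hvu => if_neg fun hleast => ?_
    exact (mem_sdiff.1 ((mem_forestMaps.1 hp).mem_of_parent hvu)).2 hleast.1
  rw [sum_congr rfl fixed_children, sum_forestWeight_filter_childrenOf hST hCT,
    sum_congr rfl away_from_children, sum_forestWeight_eq_forestEnumerator x disjoint_sdiff,
    prod_sum_scindexWeight s x S hCne, hcard, Nat.add_sub_cancel, mul_assoc]

end ScindexWeight

namespace RootedForest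

open Finset

variable {n : ℕ}

theorem mem_roots {F : RootedForest n} {v : Fin n} : v ∈ F.roots ↔ F.parent v = none := by
  simp [roots]

theorem mem_withComponents {F : RootedForest n} {k : ℕ} :
    F ∈ withComponents n k ↔ #F.roots = k := by
  simp [withComponents, components_eq_card_roots]

theorem withComponents_eq_empty {k : ℕ} (hk : n < k) : withComponents n k = ∅ := by
  refine eq_empty_of_forall_notMem fun F hF => hk.not_ge ?_
  rw [← mem_withComponents.1 hF]
  exact card_finset_fin_le F.roots

theorem nonempty_compl_roots {F : RootedForest n} {k : ℕ} (hk : k < n)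
    (hF : F ∈ withComponents n k) : F.rootsᶜ.Nonempty :=
  card_pos.1 (by rw [card_compl, Fintype.card_fin, mem_withComponents.1 hF]; lia)

theorem wellFounded_parent (F : RootedForest n) : WellFounded fun u v => F.parent v = some u := by
  have isTrans : IsTrans (Fin n) (Relation.TransGen fun u v : Fin n => F.parent v = some u) :=
    ⟨fun _ _ _ => Relation.TransGen.trans⟩
  have irrefl : Std.Irrefl (Relation.TransGen fun u v => F.parent v = some u) :=
    ⟨fun v h => F.acyclic v (Relation.transGen_swap.1 h)⟩
  have wellFounded_transGen : WellFounded (Relation.TransGen fun u v => F.parent v = some u) :=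
    Finite.wellFounded_of_trans_of_irrefl _
  exact wellFounded_transGen.mono fun _ _ h => .single h

theorem isForestMap_parent (F : RootedForest n) : IsForestMap F.roots F.rootsᶜ F.parent where
  eq_none_iff v := by rw [mem_compl, not_not, mem_roots]
  parent_mem _ := by simp only [union_compl, mem_univ]
  wellFounded := F.wellFounded_parent

/-- The forest on `[n]` with a given parent map. -/
def ofForestMap {S T : Finset (Fin n)} {p : Fin n → Option (Fin n)} (hp : IsForestMap S T p) :
    RootedForest n where
  parent := p
  acyclic v h := hp.wellFounded.transGen.irrefl.irrefl v (Relation.transGen_swap.1 h)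

theorem sum_filter_roots_eq {M : Type*} [AddCommMonoid M] (S : Finset (Fin n))
    (g : (Fin n → Option (Fin n)) → M) :
    ∑ F : RootedForest n with F.roots = S, g F.parent = ∑ p ∈ forestMaps S Sᶜ, g p := by
  refine sum_bij' (fun F _ => F.parent) (fun p hp => ofForestMap (mem_forestMaps.1 hp))
    (fun F hF => ?_) (fun p hp => ?_) (fun _ _ => rfl) (fun _ _ => rfl) (fun _ _ => rfl)
  · obtain rfl := (mem_filter.1 hF).2
    exact mem_forestMaps.2 F.isForestMap_parent
  · refine mem_filter.2 ⟨mem_univ _, ?_⟩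
    ext v
    exact mem_roots.trans (((mem_forestMaps.1 hp).eq_none_iff v).trans notMem_compl)

section MinRootChild

variable {F : RootedForest n}

theorem rootChildren_eq_childrenOf (F : RootedForest n) :
    F.rootChildren = childrenOf F.roots F.parent := by
  ext v
  simp [rootChildren]

theorem mem_minRootChild {v : Fin n} :
    v ∈ F.minRootChild ↔ v ∈ childrenOf F.roots F.parent ∧
      ∀ w ∈ childrenOf F.roots F.parent, v ≤ w := by
  rw [minRootChild, mem_filter, rootChildren_eq_childrenOf]

theorem minRootChild_eq_singleton {v : Fin n} (hv : v ∈ F.minRootChild) :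
    F.minRootChild = {v} := by
  refine eq_singleton_iff_unique_mem.2 ⟨hv, fun w hw => ?_⟩
  rw [mem_minRootChild] at hv hw
  exact (hw.2 v hv.1).antisymm (hv.2 w hw.1)

theorem minRootChild_nonempty (hF : F.rootsᶜ.Nonempty) : F.minRootChild.Nonempty := by
  have hmin := isLeast_min' _ (F.isForestMap_parent.childrenOf_nonempty hF)
  exact ⟨_, mem_minRootChild.2 ⟨hmin.1, fun w hw => hmin.2 hw⟩⟩

theorem minRootChild_subset (F : RootedForest n) : F.minRootChild ⊆ F.rootsᶜ := fun _ hv =>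
  F.isForestMap_parent.childrenOf_subset (mem_minRootChild.1 hv).1

theorem otherVertices_eq_sdiff (F : RootedForest n) :
    F.otherVertices = F.rootsᶜ \ F.minRootChild := by
  ext v
  simp [otherVertices]

theorem card_otherVertices_add_card_roots (hF : F.rootsᶜ.Nonempty) :
    #F.otherVertices + #F.roots + 1 = n := by
  obtain ⟨v, hv⟩ := minRootChild_nonempty hF
  have card_compl_roots := F.roots.card_add_card_compl
  rw [Fintype.card_fin] at card_compl_roots
  rw [otherVertices_eq_sdiff, card_sdiff_of_subset F.minRootChild_subset,
    minRootChild_eq_singleton hv, card_singleton]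
  have := hF.card_pos
  lia

theorem parents_eq (F : RootedForest n) :
    F.parents = ∑ v ∈ F.otherVertices, (F.parentLabel v - 1) + #F.otherVertices := by
  rw [parents, card_eq_sum_ones, ← sum_add_distrib]
  refine sum_congr rfl fun v hv => (Nat.sub_add_cancel ?_).symm
  rw [otherVertices_eq_sdiff, mem_sdiff, mem_compl, mem_roots] at hv
  obtain ⟨u, hu⟩ := Option.ne_none_iff_exists'.1 hv.1
  simp [parentLabel, hu]

theorem parents_add_card_roots_add_one (hF : F.rootsᶜ.Nonempty) :
    F.parents + #F.roots + 1 = n + ∑ v ∈ F.otherVertices, (F.parentLabel v - 1) := by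
  have := card_otherVertices_add_card_roots hF
  rw [parents_eq]
  lia

theorem le_parents_add {k : ℕ} (hk : k < n) (hF : F ∈ withComponents n k) :
    n ≤ F.parents + k + 1 := by
  have := parents_add_card_roots_add_one (nonempty_compl_roots hk hF)
  rw [mem_withComponents.1 hF] at this
  lia

end MinRootChild

section Weight

variable {R : Type*} [CommRing R] (r s t : R)

theorem prod_vertexWeight_roots (F : RootedForest n) :
    ∏ v ∈ F.roots, F.vertexWeight r s t v = r ^ F.niblings := by
  rw [niblings, ← prod_pow_eq_pow_sum]
  exact prod_congr rfl fun v hv => if_pos hv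

theorem weight_eq_monomial {F : RootedForest n} (hF : F.rootsᶜ.Nonempty) :
    F.weight r s t =
      r ^ F.niblings * s ^ F.scindex * t ^ ∑ v ∈ F.otherVertices, (F.parentLabel v - 1) := by
  obtain ⟨v, hv⟩ := minRootChild_nonempty hF
  have weight_min : ∏ v ∈ F.minRootChild, F.vertexWeight r s t v = s ^ F.scindex := by
    rw [minRootChild_eq_singleton hv, prod_singleton, vertexWeight,
      if_neg (mem_compl.1 (F.minRootChild_subset hv)), if_pos hv]
  rw [weight, ← prod_mul_prod_compl F.roots, prod_vertexWeight_roots,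
    ← prod_sdiff F.minRootChild_subset, weight_min, ← otherVertices_eq_sdiff, mul_comm _ (s ^ _),
    mul_assoc, ← prod_pow_eq_pow_sum]
  refine congrArg _ (congrArg _ (prod_congr rfl fun v hv => ?_))
  have hv' := (mem_filter.1 hv).2
  rw [vertexWeight, if_neg hv'.1, if_neg hv'.2]

theorem weight_of_mem_withComponents {k : ℕ} (hk : k < n) :
    ∀ F ∈ withComponents n k,
      F.weight r s t = r ^ F.niblings * s ^ F.scindex * t ^ (F.parents + k + 1 - n) := by
  intro F hF
  have nonroots := nonempty_compl_roots hk hF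
  obtain rfl := mem_withComponents.1 hF
  rw [weight_eq_monomial r s t nonroots, parents_add_card_roots_add_one nonroots,
    Nat.add_sub_cancel_left]

theorem vertexWeight_eq_scindexWeight {F : RootedForest n} {v u : Fin n}
    (hvu : F.parent v = some u) :
    F.vertexWeight r s t v =
      scindexWeight s (fun u : Fin n => t ^ (u : ℕ)) F.roots (childrenOf F.roots F.parent) v u := by
  have not_root : v ∉ F.roots := by simp [mem_roots, hvu]
  have parentLabel_eq : F.parentLabel v = u + 1 := by simp [parentLabel, hvu]
  simp only [vertexWeight, if_neg not_root, scindexWeight, ← mem_minRootChild, parentLabel_eq,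
    Nat.add_sub_cancel]
  refine ite_congr rfl (fun hv => ?_) fun _ => rfl
  simp [scindex, minRootChild_eq_singleton hv, parentLabel_eq]

theorem weight_eq_mul_forestWeight (F : RootedForest n) :
    F.weight r s t = r ^ F.niblings * forestWeight (scindexWeight s (fun u : Fin n => t ^ (u : ℕ))
      F.roots (childrenOf F.roots F.parent)) F.parent := by
  rw [weight, forestWeight, ← prod_mul_prod_compl F.roots, prod_vertexWeight_roots]
  refine congrArg _ ((prod_congr rfl fun v hv => ?_).trans
    (prod_subset (subset_univ F.rootsᶜ) fun v _ hv => ?_))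
  · obtain ⟨u, hu⟩ := Option.ne_none_iff_exists'.1 (mem_roots.not.1 (mem_compl.1 hv))
    rw [hu, Option.elim_some, vertexWeight_eq_scindexWeight r s t hu]
  · rw [mem_roots.1 (notMem_compl.1 hv), Option.elim_none]

theorem niblings_eq (F : RootedForest n) :
    F.niblings = ∑ v ∈ F.roots, #{w ∈ univ \ F.roots | w < v} := by
  refine sum_congr rfl fun v _ => congrArg card ?_
  ext w
  simp [lowerNonroots]

theorem sum_weight_filter_roots_eq {S : Finset (Fin n)} (hS : Sᶜ.Nonempty) :
    ∑ F : RootedForest n with F.roots = S, F.weight r s t =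
      r ^ (∑ v ∈ S, #{w ∈ univ \ S | w < v}) * (qNumber s #S * qNumber t n ^ (#Sᶜ - 1)) := by
  have weight_eq : ∀ F ∈ ({F | F.roots = S} : Finset (RootedForest n)), F.weight r s t =
      r ^ (∑ v ∈ S, #{w ∈ univ \ S | w < v}) * forestWeight
        (scindexWeight s (fun u : Fin n => t ^ (u : ℕ)) S (childrenOf S F.parent)) F.parent := by
    intro F hF
    obtain rfl := (mem_filter.1 hF).2
    rw [weight_eq_mul_forestWeight, niblings_eq]
  rw [sum_congr rfl weight_eq, ← mul_sum,
    sum_filter_roots_eq S fun p =>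
      forestWeight (scindexWeight s (fun u : Fin n => t ^ (u : ℕ)) S (childrenOf S p)) p,
    sum_forestWeight_scindexWeight s _ disjoint_compl_right hS, sum_add_sum_compl,
    Fin.sum_univ_eq_sum_range (fun i => t ^ i) n, qNumber, qNumber]

theorem sum_withComponents {M : Type*} [AddCommMonoid M] (k : ℕ) (g : RootedForest n → M) :
    ∑ F ∈ withComponents n k, g F =
      ∑ S ∈ univ.powersetCard k, ∑ F : RootedForest n with F.roots = S, g F := by
  rw [← sum_fiberwise_of_maps_to (g := roots) fun F hF =>
    mem_powersetCard.2 ⟨subset_univ _, mem_withComponents.1 hF⟩]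
  refine sum_congr rfl fun S hS => sum_congr ?_ fun _ _ => rfl
  ext F
  simp only [mem_filter, mem_withComponents, mem_univ, true_and, and_iff_right_iff_imp]
  rintro rfl
  exact (mem_powersetCard.1 hS).2

theorem sum_weight {k : ℕ} (hk : k < n) :
    ∑ F ∈ withComponents n k, F.weight r s t =
      qBinomial r n k * qNumber s k * qNumber t n ^ (n - k - 1) := by
  have qBinomial_eq := inversionSum_eq_qBinomial r (univ : Finset (Fin n)) (k := k)
    (by simpa using hk.le)
  rw [card_fin] at qBinomial_eq
  rw [sum_withComponents, ← qBinomial_eq, inversionSum, mul_assoc, sum_mul]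
  refine sum_congr rfl fun S hS => ?_
  have card_S := (mem_powersetCard.1 hS).2
  have card_compl_S : #Sᶜ = n - k := by rw [card_compl, Fintype.card_fin, card_S]
  rw [sum_weight_filter_roots_eq r s t (card_pos.1 (by lia)), card_S, card_compl_S]

theorem weight_of_roots_eq_univ {F : RootedForest n} (hF : F.roots = univ) :
    F.weight r s t = 1 :=
  prod_eq_one fun v _ => by simp [vertexWeight, lowerNonroots, hF]

theorem sum_weight_self : ∑ F ∈ withComponents n n, F.weight r s t = 1 := by
  have powersetCard_n : (univ : Finset (Fin n)).powersetCard n = {univ} := by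
    simpa using powersetCard_self (univ : Finset (Fin n))
  rw [sum_withComponents, powersetCard_n, sum_singleton,
    sum_congr rfl fun F hF => weight_of_roots_eq_univ r s t (mem_filter.1 hF).2,
    sum_filter_roots_eq _ fun _ => (1 : R), compl_univ, forestMaps_empty, sum_singleton]

end Weight

end RootedForest

theorem proposition3p1 {R : Type*} [CommRing R] (n k : ℕ) (r s t q : R) :
    (k < n →
      (∀ F ∈ RootedForest.withComponents n k,
        n ≤ F.parents + k + 1 ∧
        F.weight r s t = r ^ F.niblings * s ^ F.scindex * t ^ (F.parents + k + 1 - n)) ∧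
      ∑ F ∈ RootedForest.withComponents n k,
          r ^ F.niblings * s ^ F.scindex * t ^ (F.parents + k + 1 - n) =
        qBinomial r n k * qNumber s k * qNumber t n ^ (n - k - 1) ∧
      qForestsEntry q n k =
        ∑ F ∈ RootedForest.withComponents n k,
          q ^ (F.niblings + F.scindex + (F.parents + k + 1 - n))) ∧
    qForestsEntry q n k = ∑ F ∈ RootedForest.withComponents n k, F.weight q q q := by
  refine ⟨fun hk => ?_, ?_⟩
  · have weight_eq := fun r s t : R => RootedForest.weight_of_mem_withComponents r s t hk
    refine ⟨fun F hF => ⟨RootedForest.le_parents_add hk hF, weight_eq r s t F hF⟩, ?_, ?_⟩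
    · rw [← RootedForest.sum_weight r s t hk, Finset.sum_congr rfl (weight_eq r s t)]
    · rw [qForestsEntry_of_lt q hk, ← RootedForest.sum_weight q q q hk,
        Finset.sum_congr rfl (weight_eq q q q)]
      simp only [pow_add]
  · rcases lt_trichotomy k n with hk | rfl | hk
    · rw [qForestsEntry_of_lt q hk, RootedForest.sum_weight q q q hk]
    · rw [qForestsEntry_self, RootedForest.sum_weight_self]
    · rw [RootedForest.withComponents_eq_empty hk, Finset.sum_empty, qForestsEntry,
        if_neg (by lia), if_neg hk.not_ge]
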